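/- Let $\mathbb K$ be a field of characteristic $0$. For a finite digraph $G=(V,E)$ without loops and $m\ge 0$, let $R_m(V;\mathbb K)$ be the quotient of the $\mathbb K$-vector space spanned by all sequences $e_{v_0\dots v_m}$ of vertices by the span of those with $v_{k-1}=v_k$ for some $k$, with the boundary operator $\partial e_{v_0\dots v_m}=\sum_{j=0}^m(-1)^j e_{v_0\dots\widehat{v_j}\dots v_m}$ for $m\ge1$ and $\partial=0$ on $R_0$. Let $A_m(G)\subseteq R_m(V;\mathbb K)$ be the span of the $e_{v_0\dots v_m}$ with $v_{k}v_{k+1}\in E$ for $0\le k<m$, and let $\Omega_0(G)=A_0(G)$ and $\Omega_m(G)=\{u\in A_m(G):\partial u\in A_{m-1}(G)\}$ for $m\ge1$; then $(\Omega_*(G),\partial)$ is a chain complex, the path complex of $G$. For $S\subseteq\mathbb Z/n\setminus\{0\}$ let $\vec C_n^S$ be the digraph with vertex set $\mathbb Z/n$ and an arrow $a\to a+s$ for every $a\in\mathbb Z/n$ and $s\in S$. Let $n,d$ be integers with $2<d<n/2$, let $S=\{1,2,\dots,d\}\subset\mathbb Z/n$, and let $$i:(\Omega_*(\vec C_n^{\{1,2\}}),\partial)\to(\Omega_*(\vec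 C_n^{S}),\partial)$$ be the chain map given by inclusion. Then there exists a chain map $$\Pi:(\Omega_*(\vec C_n^{S}),\partial)\to(\Omega_*(\vec C_n^{\{1,2\}}),\partial)$$ such that $\Pi\circ i=\mathrm{Id}_{\Omega_*(\vec C_n^{\{1,2\}})}$ and $i\circ\Pi$ is chain-homotopic to $\mathrm{Id}_{\Omega_*(\vec C_n^{S})}$. -/

import Mathlib

open CategoryTheory

universe u v

noncomputable section

namespace PathHomology

section Paths

variable (K : Type u) [Field K] (V : Type v)

/-- `Λ_m(V; K)`: the `K`-vector space with basis the elementary `m`-paths `(v₀, …, v_m)` in `V`. -/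
abbrev ElemChain (m : ℕ) : Type max u v := (Fin (m + 1) → V) →₀ K

variable {V}

/-- The elementary path obtained from `p` by deleting the vertex with index `j`. -/
def face {m : ℕ} (p : Fin (m + 2) → V) (j : Fin (m + 2)) : Fin (m + 1) → V :=
  fun k => p (j.succAbove k)

variable (V)

/-- `∂ e_{v₀ … v_{m+1}} = ∑ⱼ (-1)^j e_{v₀ … v̂ⱼ … v_{m+1}}`, extended linearly. -/
def elemBoundary (m : ℕ) : ElemChain K V (m + 1) →ₗ[K] ElemChain K V m :=
  Finsupp.linearCombination K fun p : Fin (m + 2) → V =>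
    ∑ j : Fin (m + 2), (-1 : K) ^ (j : ℕ) • Finsupp.single (face p j) (1 : K)

/-- `I_m(V; K)`: the span of the irregular elementary paths, those in which two consecutive
vertices coincide. -/
def irregular (m : ℕ) : Submodule K (ElemChain K V m) :=
  Submodule.span K
    {x | ∃ p : Fin (m + 1) → V, (∃ k : Fin m, p k.castSucc = p k.succ) ∧
      x = Finsupp.single p (1 : K)}

theorem elemBoundary_single (m : ℕ) (p : Fin (m + 2) → V) :
    elemBoundary K V m (Finsupp.single p 1) =
      ∑ j : Fin (m + 2), (-1 : K) ^ (j : ℕ) • Finsupp.single (face p j) (1 : K) := by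
  simp [elemBoundary]

theorem face_face {m : ℕ} (p : Fin (m + 3) → V) (i : Fin (m + 2)) (j : Fin (m + 3))
    (h : (j : ℕ) ≤ (i : ℕ)) :
    face (face p j) i = face (face p i.succ) (j.castLT (lt_of_le_of_lt h i.is_lt)) := by
  funext k
  simp only [face]
  congr 1
  ext
  simp only [Fin.succAbove, Fin.lt_def, Fin.val_castSucc, Fin.val_succ, Fin.val_castLT]
  split_ifs <;> simp_all <;> omega

theorem elemBoundary_elemBoundary (m : ℕ) (x : ElemChain K V (m + 2)) :
    elemBoundary K V m (elemBoundary K V (m + 1) x) = 0 := by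
  suffices h : elemBoundary K V m ∘ₗ elemBoundary K V (m + 1) = 0 from LinearMap.congr_fun h x
  refine Finsupp.lhom_ext' fun p => LinearMap.ext_ring ?_
  simp only [LinearMap.comp_apply, Finsupp.lsingle_apply, elemBoundary_single, map_sum, map_smul,
    LinearMap.zero_apply, Finset.smul_sum, smul_smul]
  rw [← Finset.sum_product']
  let P := Fin (m + 3) × Fin (m + 2)
  let S : Finset P := {ji : P | (ji.1 : ℕ) ≤ (ji.2 : ℕ)}
  rw [Finset.univ_product_univ, ← Finset.sum_add_sum_compl S, ← eq_neg_iff_add_eq_zero,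
    ← Finset.sum_neg_distrib]
  let φ : ∀ ji : P, ji ∈ S → P := fun ji hji =>
    (ji.2.succ, ji.1.castLT (lt_of_le_of_lt (Finset.mem_filter.mp hji).right ji.2.is_lt))
  apply Finset.sum_bij φ
  · intro ji hji
    simp only [S, φ, Finset.compl_filter, Finset.mem_filter_univ, Fin.val_succ,
      Fin.val_castLT] at hji ⊢
    omega
  · rintro ⟨j, i⟩ hij ⟨j', i'⟩ hij' h
    have h1 : i.succ = i'.succ := congr_arg Prod.fst h
    have h2 := congr_arg (fun ji : P => (ji.2 : ℕ)) h
    exact Prod.ext (Fin.ext h2) (Fin.succ_injective _ h1)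
  · rintro ⟨j', i'⟩ hij'
    simp only [S, Finset.compl_filter, Finset.mem_filter_univ, not_le] at hij'
    have hj : j' ≠ 0 := by rintro rfl; simp at hij'
    refine ⟨(i'.castSucc, j'.pred hj), ?_, ?_⟩
    · simp only [S, Finset.mem_filter_univ, Fin.val_castSucc, Fin.val_pred]
      omega
    · simp [φ]
  · rintro ⟨j, i⟩ hij
    have hle : (j : ℕ) ≤ (i : ℕ) := by simpa [S] using hij
    simp only [φ, Fin.val_succ, Fin.val_castLT, ← neg_smul]
    rw [face_face V p i j hle]
    congr 1
    rw [pow_succ]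
    ring

theorem elemBoundary_mem_irregular (m : ℕ) :
    irregular K V (m + 1) ≤ (irregular K V m).comap (elemBoundary K V m) := by
  refine Submodule.span_le.2 ?_
  rintro _ ⟨p, ⟨k, hk⟩, rfl⟩
  simp only [SetLike.mem_coe, Submodule.mem_comap, elemBoundary_single]
  have hne : k.castSucc ≠ k.succ := Fin.castSucc_lt_succ.ne
  rw [← Finset.add_sum_erase _ _ (Finset.mem_univ k.castSucc),
    ← Finset.add_sum_erase _ _ (Finset.mem_erase.2 ⟨hne.symm, Finset.mem_univ k.succ⟩), ← add_assoc]
  refine Submodule.add_mem _ ?_ (Submodule.sum_mem _ fun j hj => ?_)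
  · have hf : face p k.castSucc = face p k.succ := by
      funext l
      simp only [face]
      rcases lt_trichotomy l k with h | rfl | h
      · rw [Fin.succAbove_of_castSucc_lt _ _ (by simpa using h),
          Fin.succAbove_of_castSucc_lt _ _ (Fin.castSucc_lt_succ_iff.2 h.le)]
      · simp [hk]
      · rw [Fin.succAbove_of_le_castSucc _ _ (by simpa using h.le),
          Fin.succAbove_of_le_castSucc _ _ (Fin.succ_le_castSucc_iff.2 h)]
    rw [hf, ← add_smul]
    simp [pow_succ]
  · simp only [Finset.mem_erase, Finset.mem_univ, and_true, ne_eq, Fin.ext_iff, Fin.val_succ,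
      Fin.val_castSucc] at hj
    refine Submodule.smul_mem _ _ (Submodule.subset_span ⟨_, ?_, rfl⟩)
    have hj2 := j.is_lt
    have hk2 := k.is_lt
    by_cases h : (j : ℕ) < k
    · refine ⟨⟨k - 1, by omega⟩, ?_⟩
      simp only [face]
      convert hk using 2 <;> ext <;>
        simp only [Fin.succAbove, Fin.lt_def, Fin.val_castSucc, Fin.val_succ] <;>
        split_ifs <;> simp <;> omega
    · refine ⟨⟨k, by omega⟩, ?_⟩
      simp only [face]
      convert hk using 2 <;> ext <;>
        simp only [Fin.succAbove, Fin.lt_def, Fin.val_castSucc, Fin.val_succ] <;>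
        split_ifs <;> simp <;> omega

/-- `R_m(V; K) = Λ_m(V; K) / I_m(V; K)`: the regular `m`-paths. -/
abbrev Regular (m : ℕ) : Type max u v := ElemChain K V m ⧸ irregular K V m

/-- The boundary operator induced on regular paths. -/
def boundary (m : ℕ) : Regular K V (m + 1) →ₗ[K] Regular K V m :=
  Submodule.mapQ _ _ (elemBoundary K V m) (elemBoundary_mem_irregular K V m)

theorem boundary_boundary (m : ℕ) (x : Regular K V (m + 2)) :
    boundary K V m (boundary K V (m + 1) x) = 0 := by
  obtain ⟨y, rfl⟩ := Submodule.mkQ_surjective _ x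
  simp [boundary, elemBoundary_elemBoundary]

variable {V}

/-- The class of the elementary path `p` in `R_m(V; K)`. -/
def elem {m : ℕ} (p : Fin (m + 1) → V) : Regular K V m :=
  (irregular K V m).mkQ (Finsupp.single p 1)

/-- `A_m(G; K)`: the span of the elementary paths all of whose steps are edges of `G`. -/
def allowed (G : Digraph V) (m : ℕ) : Submodule K (Regular K V m) :=
  Submodule.span K
    {x | ∃ p : Fin (m + 1) → V, (∀ k : Fin m, G.Adj (p k.castSucc) (p k.succ)) ∧ x = elem K p}

/-- `Ω_m(G; K)`: the `∂`-invariant allowed paths, `u ∈ A_m` with `∂u ∈ A_{m-1}`. There is no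
condition on the boundary in degree `0`, and in degree `1` it is void (`Omega_one`). -/
def Omega (G : Digraph V) : (m : ℕ) → Submodule K (Regular K V m)
  | 0 => allowed K G 0
  | m + 1 => allowed K G (m + 1) ⊓ (allowed K G m).comap (boundary K V m)

theorem allowed_zero (G : Digraph V) : allowed K G 0 = ⊤ := by
  rw [eq_top_iff]
  rintro x -
  obtain ⟨y, rfl⟩ := Submodule.mkQ_surjective _ x
  induction y using Finsupp.induction_linear with
  | zero => simp
  | add f g hf hg => rw [map_add]; exact Submodule.add_mem _ hf hg
  | single p c =>
    have h : (Finsupp.single p c : ElemChain K V 0) = c • Finsupp.single p 1 := by simp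
    rw [h, map_smul]
    exact Submodule.smul_mem _ _ (Submodule.subset_span ⟨p, fun k => k.elim0, rfl⟩)

theorem Omega_one (G : Digraph V) : Omega K G 1 = allowed K G 1 := by
  simp [Omega, allowed_zero]

theorem Omega_le_allowed (G : Digraph V) (m : ℕ) : Omega K G m ≤ allowed K G m := by
  cases m with
  | zero => exact le_rfl
  | succ m => exact inf_le_left

theorem boundary_mem_Omega (G : Digraph V) (m : ℕ) (x : Regular K V (m + 1))
    (hx : x ∈ Omega K G (m + 1)) : boundary K V m x ∈ Omega K G m := by
  cases m with
  | zero => exact hx.2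
  | succ m =>
    refine ⟨hx.2, ?_⟩
    change boundary K V m (boundary K V (m + 1) x) ∈ allowed K G m
    rw [boundary_boundary]
    exact Submodule.zero_mem _

/-- The boundary operator `Ω_{m+1}(G; K) → Ω_m(G; K)`. -/
def OmegaBoundary (G : Digraph V) (m : ℕ) : Omega K G (m + 1) →ₗ[K] Omega K G m :=
  (boundary K V m).restrict (boundary_mem_Omega K G m)

/-- The path complex `(Ω_*(G; K), ∂)` of the digraph `G`. -/
def pathComplex (G : Digraph V) : ChainComplex (ModuleCat.{max u v} K) ℕ :=
  ChainComplex.of (fun m => ModuleCat.of K (Omega K G m))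
    (fun m => ModuleCat.ofHom (OmegaBoundary K G m)) (by
      intro m
      refine ModuleCat.hom_ext (LinearMap.ext fun x => Subtype.ext ?_)
      exact boundary_boundary K V m x)

theorem allowed_mono {G H : Digraph V} (h : G ≤ H) (m : ℕ) : allowed K G m ≤ allowed K H m := by
  refine Submodule.span_mono ?_
  rintro _ ⟨p, hp, rfl⟩
  exact ⟨p, fun k => h (hp k), rfl⟩

theorem Omega_mono {G H : Digraph V} (h : G ≤ H) (m : ℕ) : Omega K G m ≤ Omega K H m := by
  cases m with
  | zero => exact allowed_mono K h 0
  | succ m => exact inf_le_inf (allowed_mono K h _) (Submodule.comap_mono (allowed_mono K h _))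

/-- The chain map `Ω_*(G; K) → Ω_*(H; K)` induced by the embedding of a digraph `G` into a digraph
`H` on the same vertices: in each degree it is the inclusion of subspaces of `R_m(V; K)`. -/
def pathInclusion {G H : Digraph V} (h : G ≤ H) : pathComplex K G ⟶ pathComplex K H :=
  ChainComplex.ofHom
    (fun m => ModuleCat.ofHom (Submodule.inclusion (Omega_mono K h m))) (by
      intro m
      simp only [pathComplex, ChainComplex.of_d]
      rfl)

end Paths

/-- The circulant digraph with vertex set `ℤ/n` and an arrow `a → a + s` for every `s ∈ S`. -/
def circulant (n : ℕ) (S : Set (ZMod n)) : Digraph (ZMod n) where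
  Adj a b := ∃ s ∈ S, b = a + s

theorem circulant_mono {n : ℕ} {S T : Set (ZMod n)} (h : S ⊆ T) : circulant n S ≤ circulant n T := by
  rintro a b ⟨s, hs, rfl⟩
  exact ⟨s, h hs, rfl⟩

/-- The connection set `{1, 2, …, d}` in `ℤ/n`. -/
def stepsUpTo (n d : ℕ) : Set (ZMod n) :=
  (fun k : ℕ => (k : ZMod n)) '' Set.Icc 1 d

theorem one_two_subset_stepsUpTo (n : ℕ) {d : ℕ} (hd : 2 < d) :
    ({1, 2} : Set (ZMod n)) ⊆ stepsUpTo n d := by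
  rintro s (rfl | rfl)
  · exact ⟨1, ⟨le_rfl, by omega⟩, by simp⟩
  · exact ⟨2, ⟨by omega, hd.le⟩, by simp⟩

end PathHomology

end

open PathHomology

/-! Let `D` cut the first step of a path into unit steps: `e_{v₀v₁…}` goes to the sum of `e_{v₀+k,
v₀+k+1, v₁, …}` over `k < v₁ - v₀`, and `D = 0` in degree `0`. When two consecutive steps never wrap
around `ℤ/n` (`2d < n`), `1 + ∂D + D∂` vanishes in degrees at least `2`; in degree `1` it replaces
an edge by the chain of unit edges between its ends. So its image lies in `Ω_*(G)` as soon as `G`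
has the unit steps (`boundary_subdivide_add`, `boundary_subdivide_edge`).

This map need not fix `Ω_*(G)`. As `D` preserves `Ω_*(G)` and `i` has linear left inverses `r`, put
`L = irD - D`. Then `L` vanishes on `Ω_*(G)`, and `1 - ∂L - L∂` differs from `1 + ∂D + D∂` by terms
in `Ω_*(G)`. It is therefore a retraction homotopic to the identity. -/

noncomputable section

namespace PathHomology

universe w

/-! ### The subdivision operator and its homotopy formula -/

section Subdivision

variable (K : Type w) [Field K]

theorem elem_eq_zero {V : Type*} {m : ℕ} {p : Fin (m + 1) → V} (k : Fin m)
    (hk : p k.castSucc = p k.succ) : elem K p = 0 := by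
  rw [elem, Submodule.mkQ_apply, Submodule.Quotient.mk_eq_zero]
  exact Submodule.subset_span ⟨p, ⟨k, hk⟩, rfl⟩

theorem boundary_elem {V : Type*} {m : ℕ} (p : Fin (m + 2) → V) :
    boundary K V m (elem K p) = ∑ j : Fin (m + 2), (-1 : K) ^ (j : ℕ) • elem K (face p j) := by
  rw [boundary, elem, Submodule.mkQ_apply, Submodule.mapQ_apply, elemBoundary_single,
    ← Submodule.mkQ_apply, map_sum]
  simp only [map_smul, elem]

theorem face_cons_zero {V : Type*} {m : ℕ} (a : V) (p : Fin (m + 1) → V) :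
    face (Fin.cons a p : Fin (m + 2) → V) 0 = p := by
  funext k
  simp [face]

theorem face_cons_succ {V : Type*} {m : ℕ} (a : V) (p : Fin (m + 2) → V) (j : Fin (m + 2)) :
    face (Fin.cons a p : Fin (m + 3) → V) j.succ = Fin.cons a (face p j) := by
  funext k
  refine Fin.cases ?_ (fun k => ?_) k <;> simp [face]

theorem face_cons_one {V : Type*} {m : ℕ} (a b : V) (q : Fin m → V) :
    face (Fin.cons a (Fin.cons b q : Fin (m + 1) → V) : Fin (m + 2) → V) 1 = Fin.cons a q := by
  funext k
  refine Fin.cases ?_ (fun k => ?_) k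
  · simp [face]
  · simp only [face, Fin.cons_succ]
    rw [show (1 : Fin (m + 2)).succAbove k.succ = k.succ.succ from
      Fin.succAbove_of_le_castSucc _ _ (by simp [Fin.le_def])]
    simp

/-- The boundary of `e_{a b q}`, with the two first faces separated. -/
theorem boundary_elem_cons_cons {V : Type*} {m : ℕ} (a b : V) (q : Fin (m + 1) → V) :
    boundary K V (m + 1) (elem K (Fin.cons a (Fin.cons b q : Fin (m + 2) → V) : Fin (m + 3) → V)) =
      elem K (Fin.cons b q : Fin (m + 2) → V) - elem K (Fin.cons a q : Fin (m + 2) → V) +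
        ∑ j : Fin (m + 1), (-1 : K) ^ (j : ℕ) •
          elem K (Fin.cons a (Fin.cons b (fun i => q (j.succAbove i)) : Fin (m + 1) → V) :
            Fin (m + 2) → V) := by
  rw [boundary_elem, Fin.sum_univ_succ, Fin.sum_univ_succ, face_cons_zero]
  have h1 : (Fin.succ 0 : Fin (m + 3)) = 1 := rfl
  rw [h1, face_cons_one]
  simp only [Fin.val_zero, pow_zero, one_smul, Fin.val_one, pow_one, neg_smul, sub_eq_add_neg,
    add_assoc]
  congr 2
  refine Finset.sum_congr rfl fun j _ => ?_
  rw [face_cons_succ]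
  have h2 : face (Fin.cons b q : Fin (m + 2) → V) j.succ =
      (Fin.cons b (fun i => q (j.succAbove i)) : Fin (m + 1) → V) := by
    funext k
    refine Fin.cases ?_ (fun k => ?_) k <;> simp [face]
  rw [h2]
  simp [pow_succ]

variable {n : ℕ}

/-- The path obtained from `v₀ v₁ …` by replacing `v₀` with the two vertices `v₀ + k`,
`v₀ + k + 1`. -/
def subdividedPath {m : ℕ} (p : Fin (m + 2) → ZMod n) (k : ℕ) : Fin (m + 3) → ZMod n :=
  Fin.cons (p 0 + k) (Fin.cons (p 0 + k + 1) (Fin.tail p))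

variable (n)

/-- `e_{v₀ v₁ …} ↦ ∑ₖ e_{v₀ + k, v₀ + k + 1, v₁, …}`, where `k` runs over the residues smaller than
`v₁ - v₀`; before passing to regular paths. -/
def elemSubdivide (m : ℕ) : ElemChain K (ZMod n) (m + 1) →ₗ[K] Regular K (ZMod n) (m + 2) :=
  Finsupp.linearCombination K fun p : Fin (m + 2) → ZMod n =>
    ∑ k ∈ Finset.range (p 1 - p 0).val, elem K (subdividedPath p k)

theorem irregular_le_ker_elemSubdivide (m : ℕ) :
    irregular K (ZMod n) (m + 1) ≤ LinearMap.ker (elemSubdivide K n m) := by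
  refine Submodule.span_le.2 ?_
  rintro _ ⟨p, ⟨k, hk⟩, rfl⟩
  simp only [SetLike.mem_coe, LinearMap.mem_ker, elemSubdivide, Finsupp.linearCombination_single,
    one_smul]
  induction k using Fin.cases with
  | zero =>
    have h : p 1 = p 0 := hk.symm
    simp [h]
  | succ k =>
    refine Finset.sum_eq_zero fun i _ => elem_eq_zero K k.succ.succ ?_
    simpa [subdividedPath, Fin.tail, ← Fin.succ_castSucc] using hk

/-- The contracting operator on regular paths in positive degrees. -/
def subdivide (m : ℕ) : Regular K (ZMod n) (m + 1) →ₗ[K] Regular K (ZMod n) (m + 2) :=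
  Submodule.liftQ _ (elemSubdivide K n m) (irregular_le_ker_elemSubdivide K n m)

theorem subdivide_elem {m : ℕ} (p : Fin (m + 2) → ZMod n) :
    subdivide K n m (elem K p) =
      ∑ k ∈ Finset.range (p 1 - p 0).val, elem K (subdividedPath p k) := by
  simp [subdivide, elem, elemSubdivide]

variable {n}

theorem subdivide_elem_cons_cons {m : ℕ} (a b : ZMod n) (q : Fin m → ZMod n) :
    subdivide K n m (elem K (Fin.cons a (Fin.cons b q : Fin (m + 1) → ZMod n) :
        Fin (m + 2) → ZMod n)) =
      ∑ k ∈ Finset.range (b - a).val, elem K (Fin.cons (a + k) (Fin.cons (a + k + 1)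
        (Fin.cons b q : Fin (m + 1) → ZMod n) : Fin (m + 2) → ZMod n) : Fin (m + 3) → ZMod n) := by
  rw [subdivide_elem]
  rfl

theorem subdivide_elem_cons {m : ℕ} (a : ZMod n) (q : Fin (m + 1) → ZMod n) :
    subdivide K n m (elem K (Fin.cons a q : Fin (m + 2) → ZMod n)) =
      ∑ k ∈ Finset.range (q 0 - a).val, elem K (Fin.cons (a + k) (Fin.cons (a + k + 1) q :
        Fin (m + 2) → ZMod n) : Fin (m + 3) → ZMod n) := by
  rw [subdivide_elem]
  rfl

/-- The telescoping sum of the two first faces of the subdivided paths. -/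
theorem sum_range_elem_cons_sub [NeZero n] {m : ℕ} (a b : ZMod n) (q : Fin m → ZMod n) :
    ∑ k ∈ Finset.range (b - a).val,
      (elem K (Fin.cons (a + k + 1) (Fin.cons b q : Fin (m + 1) → ZMod n) : Fin (m + 2) → ZMod n) -
        elem K (Fin.cons (a + k) (Fin.cons b q : Fin (m + 1) → ZMod n) : Fin (m + 2) → ZMod n)) =
      -elem K (Fin.cons a (Fin.cons b q : Fin (m + 1) → ZMod n) : Fin (m + 2) → ZMod n) := by
  have h := Finset.sum_range_sub (fun k : ℕ => elem K (Fin.cons (a + k)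
    (Fin.cons b q : Fin (m + 1) → ZMod n) : Fin (m + 2) → ZMod n)) (b - a).val
  simp only [Nat.cast_add, Nat.cast_one, ← add_assoc, ZMod.natCast_val, ZMod.cast_id', id,
    add_sub_cancel, Nat.cast_zero, add_zero] at h
  -- The upper end of the telescope is `e_{b b q}`, which is irregular.
  rw [h, elem_eq_zero K 0 (by simp), zero_sub]

theorem boundary_subdivide_edge [NeZero n] (p : Fin 2 → ZMod n) :
    boundary K (ZMod n) 1 (subdivide K n 0 (elem K p)) = -elem K p +
      ∑ k ∈ Finset.range (p 1 - p 0).val, elem K ![p 0 + k, p 0 + k + 1] := by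
  obtain ⟨a, b, rfl⟩ : ∃ a b, p = Fin.cons a (Fin.cons b Fin.elim0 : Fin 1 → ZMod n) :=
    ⟨p 0, p 1, by funext i; fin_cases i <;> rfl⟩
  rw [subdivide_elem_cons_cons, map_sum]
  rw [Finset.sum_congr rfl fun k _ => boundary_elem_cons_cons K (m := 0) _ _ _,
    Finset.sum_add_distrib, sum_range_elem_cons_sub]
  congr 1
  refine Finset.sum_congr rfl fun k _ => ?_
  rw [Fin.sum_univ_succ, Fin.sum_univ_zero, add_zero, Fin.val_zero, pow_zero, one_smul]
  refine congrArg _ ?_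
  funext i
  fin_cases i <;> rfl

/-- `∂H + H∂ = -1` on a path of length at least two whose two first steps do not wrap around. -/
theorem boundary_subdivide_add [NeZero n] {m : ℕ} (p : Fin (m + 3) → ZMod n)
    (hp : (p 1 - p 0).val + (p 2 - p 1).val < n) :
    boundary K (ZMod n) (m + 2) (subdivide K n (m + 1) (elem K p)) +
      subdivide K n m (boundary K (ZMod n) (m + 1) (elem K p)) = -elem K p := by
  obtain ⟨a, b, q, rfl⟩ : ∃ (a b : ZMod n) (q : Fin (m + 1) → ZMod n),
      p = Fin.cons a (Fin.cons b q : Fin (m + 2) → ZMod n) :=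
    ⟨p 0, p 1, Fin.tail (Fin.tail p), by
      funext i
      refine Fin.cases rfl (fun i => ?_) i
      refine Fin.cases rfl (fun i => rfl) i⟩
  replace hp : (b - a).val + (q 0 - b).val < n := hp
  -- No wrapping: the subdivision of `a → q 0` is that of `a → b` followed by that of `b → q 0`. The
  -- second piece cancels against the face deleting `a`.
  have hval : (q 0 - a).val = (b - a).val + (q 0 - b).val := by
    rw [← ZMod.val_add_of_lt hp]
    congr 1
    ring
  rw [subdivide_elem_cons_cons, boundary_elem_cons_cons, map_sum, map_add, map_sub, map_sum,
    subdivide_elem_cons, subdivide_elem_cons, hval, Finset.sum_range_add]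
  simp only [map_smul, subdivide_elem_cons_cons, boundary_elem_cons_cons, Nat.cast_add,
    ← add_assoc, ZMod.natCast_val, ZMod.cast_id', id, add_sub_cancel]
  rw [Finset.sum_add_distrib, sum_range_elem_cons_sub]
  -- Deleting `b` (`j = 0`) cancels the first piece of the subdivided `e_{a q}`; the faces that keep
  -- `b` acquire a sign and cancel the subdivisions of the later faces.
  have hfaces (k : ℕ) : (∑ j : Fin (m + 2), (-1 : K) ^ (j : ℕ) • elem K (Fin.cons (a + k)
      (Fin.cons (a + k + 1) (fun i => (Fin.cons b q : Fin (m + 2) → ZMod n) (j.succAbove i)) :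
        Fin (m + 2) → ZMod n) : Fin (m + 3) → ZMod n)) =
      elem K (Fin.cons (a + k) (Fin.cons (a + k + 1) q : Fin (m + 2) → ZMod n) :
        Fin (m + 3) → ZMod n) -
      ∑ j : Fin (m + 1), (-1 : K) ^ (j : ℕ) • elem K (Fin.cons (a + k) (Fin.cons (a + k + 1)
        (Fin.cons b (fun i => q (j.succAbove i)) : Fin (m + 1) → ZMod n) :
          Fin (m + 2) → ZMod n) : Fin (m + 3) → ZMod n) := by
    rw [Fin.sum_univ_succ, sub_eq_add_neg, ← Finset.sum_neg_distrib]
    congr 1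
    · simp
    · refine Finset.sum_congr rfl fun j _ => ?_
      have h : (fun i => (Fin.cons b q : Fin (m + 2) → ZMod n) (j.succ.succAbove i)) =
          (Fin.cons b (fun i => q (j.succAbove i)) : Fin (m + 1) → ZMod n) := by
        funext k
        refine Fin.cases ?_ (fun k => ?_) k <;> simp
      rw [h]
      simp [pow_succ]
  simp only [hfaces, Finset.sum_sub_distrib, Finset.smul_sum]
  rw [Finset.sum_comm (s := Finset.univ)]
  abel

end Subdivision

/-! ### Subdivision on circulant digraphs -/

section Contraction

variable (K : Type w) [Field K] {n : ℕ}

/-- The arrows of `G` are the steps of length `1, …, d`. -/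
def HasStepsUpTo (G : Digraph (ZMod n)) (d : ℕ) : Prop :=
  ∀ a b, G.Adj a b ↔ 1 ≤ (b - a).val ∧ (b - a).val ≤ d

theorem hasStepsUpTo_circulant {d : ℕ} (hn : d < n) :
    HasStepsUpTo (circulant n (stepsUpTo n d)) d := by
  have : NeZero n := ⟨by omega⟩
  intro a b
  constructor
  · rintro ⟨_, ⟨k, ⟨hk1, hk2⟩, rfl⟩, rfl⟩
    rw [add_sub_cancel_left, ZMod.val_natCast_of_lt (by omega)]
    exact ⟨hk1, hk2⟩
  · intro h
    exact ⟨b - a, ⟨(b - a).val, h, by simp⟩, by ring⟩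

theorem stepsUpTo_two (n : ℕ) : stepsUpTo n 2 = {1, 2} := by
  ext s
  constructor
  · rintro ⟨k, ⟨hk1, hk2⟩, rfl⟩
    obtain rfl | rfl : k = 1 ∨ k = 2 := by omega
    · simp
    · simp
  · rintro (rfl | rfl)
    · exact ⟨1, ⟨le_rfl, by omega⟩, by simp⟩
    · exact ⟨2, ⟨by omega, le_rfl⟩, by simp⟩

variable {G : Digraph (ZMod n)} {d : ℕ}

theorem elem_mem_allowed {m : ℕ} {p : Fin (m + 1) → ZMod n}
    (hp : ∀ k : Fin m, G.Adj (p k.castSucc) (p k.succ)) : elem K p ∈ allowed K G m :=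
  Submodule.subset_span ⟨p, hp, rfl⟩

theorem HasStepsUpTo.adj_add_one (hG : HasStepsUpTo G d) (hd : 1 ≤ d) (hn : 1 < n) (a : ZMod n) :
    G.Adj a (a + 1) := by
  have : Fact (1 < n) := ⟨hn⟩
  rw [hG, add_sub_cancel_left, ZMod.val_one]
  exact ⟨le_rfl, hd⟩

/-- The first step becomes a unit step followed by a step shorter than the original one, or by a
degenerate step when `k` is last. -/
theorem HasStepsUpTo.subdivide_mem_allowed (hG : HasStepsUpTo G d) (hd : 1 ≤ d) (hn : 1 < n)
    {m : ℕ} {x : Regular K (ZMod n) (m + 1)} (hx : x ∈ allowed K G (m + 1)) :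
    subdivide K n m x ∈ allowed K G (m + 2) := by
  have : NeZero n := ⟨by omega⟩
  suffices h : allowed K G (m + 1) ≤ (allowed K G (m + 2)).comap (subdivide K n m) from h hx
  refine Submodule.span_le.2 ?_
  rintro _ ⟨p, hp, rfl⟩
  rw [SetLike.mem_coe, Submodule.mem_comap, subdivide_elem]
  refine Submodule.sum_mem _ fun k hk => ?_
  rw [Finset.mem_range] at hk
  have h0 : G.Adj (p 0) (p 1) := hp 0
  rw [hG] at h0
  have hlt := ZMod.val_lt (p 1 - p 0)
  have hval : (p 1 - (p 0 + k + 1)).val = (p 1 - p 0).val - (k + 1) := by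
    have h : p 1 - (p 0 + k + 1) = (((p 1 - p 0).val - (k + 1) : ℕ) : ZMod n) := by
      rw [Nat.cast_sub hk]
      simp
      ring
    rw [h, ZMod.val_natCast_of_lt (by omega)]
  by_cases hk' : k + 1 = (p 1 - p 0).val
  · have h1 : p 0 + k + 1 = p 1 := by
      have h : ((k + 1 : ℕ) : ZMod n) = p 1 - p 0 := by rw [hk']; simp
      push_cast at h
      rw [add_assoc, h]
      ring
    rw [elem_eq_zero K 1 h1]
    exact Submodule.zero_mem _
  · refine elem_mem_allowed K fun i => ?_
    induction i using Fin.cases with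
    | zero => exact hG.adj_add_one hd hn _
    | succ i =>
      induction i using Fin.cases with
      | zero =>
        change G.Adj (p 0 + k + 1) (p 1)
        rw [hG, hval]
        omega
      | succ i =>
        exact hp i.succ

/-- Only unit edges survive the telescoping, so the arrows of `H` play no role. -/
theorem HasStepsUpTo.boundary_subdivide_edge_add_mem (hG : HasStepsUpTo G d) (hd : 1 ≤ d)
    (hn : 1 < n) {H : Digraph (ZMod n)} {x : Regular K (ZMod n) 1} (hx : x ∈ allowed K H 1) :
    x + boundary K (ZMod n) 1 (subdivide K n 0 x) ∈ allowed K G 1 := by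
  have : NeZero n := ⟨by omega⟩
  suffices h : allowed K H 1 ≤ (allowed K G 1).comap
      (LinearMap.id + boundary K (ZMod n) 1 ∘ₗ subdivide K n 0) from h hx
  refine Submodule.span_le.2 ?_
  rintro _ ⟨p, -, rfl⟩
  simp only [SetLike.mem_coe, Submodule.mem_comap, LinearMap.add_apply, LinearMap.id_apply,
    LinearMap.comp_apply, boundary_subdivide_edge, add_neg_cancel_left]
  refine Submodule.sum_mem _ fun k _ => elem_mem_allowed K fun i => ?_
  obtain rfl : i = 0 := Subsingleton.elim _ _
  exact hG.adj_add_one hd hn _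

theorem HasStepsUpTo.boundary_subdivide_add_subdivide_boundary (hG : HasStepsUpTo G d)
    (hn : 2 * d < n) {m : ℕ} {x : Regular K (ZMod n) (m + 2)} (hx : x ∈ allowed K G (m + 2)) :
    boundary K (ZMod n) (m + 2) (subdivide K n (m + 1) x) +
      subdivide K n m (boundary K (ZMod n) (m + 1) x) = -x := by
  have : NeZero n := ⟨by omega⟩
  suffices h : allowed K G (m + 2) ≤ LinearMap.eqLocus
      (boundary K (ZMod n) (m + 2) ∘ₗ subdivide K n (m + 1) +
        subdivide K n m ∘ₗ boundary K (ZMod n) (m + 1)) (-LinearMap.id) from h hx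
  refine Submodule.span_le.2 ?_
  rintro _ ⟨p, hp, rfl⟩
  have h0 : G.Adj (p 0) (p 1) := hp 0
  have h1 : G.Adj (p 1) (p 2) := hp 1
  rw [hG] at h0 h1
  exact boundary_subdivide_add K p (by omega)

theorem HasStepsUpTo.subdivide_mem_Omega (hG : HasStepsUpTo G d) (hd : 1 ≤ d) (hn : 2 * d < n)
    {m : ℕ} {x : Regular K (ZMod n) (m + 1)} (hx : x ∈ Omega K G (m + 1)) :
    subdivide K n m x ∈ Omega K G (m + 2) := by
  refine ⟨hG.subdivide_mem_allowed K hd (by omega) hx.1, ?_⟩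
  change boundary K (ZMod n) (m + 1) (subdivide K n m x) ∈ allowed K G (m + 1)
  cases m with
  | zero =>
    have h := hG.boundary_subdivide_edge_add_mem K hd (by omega) hx.1
    simpa using Submodule.sub_mem _ h hx.1
  | succ m =>
    -- The homotopy formula gives `∂Dx = -x - D∂x`, and both terms are allowed.
    rw [eq_sub_of_add_eq (hG.boundary_subdivide_add_subdivide_boundary K hn hx.1)]
    exact Submodule.sub_mem _ (Submodule.neg_mem _ hx.1)
      (hG.subdivide_mem_allowed K hd (by omega) hx.2)

/-- The contracting operator on the path complex, zero in degree `0`. -/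
def omegaSubdivide (hG : HasStepsUpTo G d) (hd : 1 ≤ d) (hn : 2 * d < n) :
    (m : ℕ) → Omega K G m →ₗ[K] Omega K G (m + 1)
  | 0 => 0
  | m + 1 => (subdivide K n m).restrict fun _ hx => hG.subdivide_mem_Omega K hd hn hx

end Contraction

/-! ### Deformation retractions from homotopy operators -/

section Retract

variable (K : Type w) [Field K] {V : Type*} {G H : Digraph V}

/-- The degree `m` part of a null-homotopic endomorphism of a path complex, as a linear map. -/
def omegaNullHomotopic (G : Digraph V) (L : ∀ m, Omega K G m →ₗ[K] Omega K G (m + 1)) :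
    (m : ℕ) → Omega K G m →ₗ[K] Omega K G m
  | 0 => OmegaBoundary K G 0 ∘ₗ L 0
  | m + 1 => OmegaBoundary K G (m + 1) ∘ₗ L (m + 1) + L m ∘ₗ OmegaBoundary K G m

theorem omegaNullHomotopic_inclusion (h : G ≤ H)
    (L : ∀ m, Omega K H m →ₗ[K] Omega K H (m + 1))
    (hL : ∀ m x, L m (Submodule.inclusion (Omega_mono K h m) x) = 0) (m : ℕ) (x : Omega K G m) :
    omegaNullHomotopic K H L m (Submodule.inclusion (Omega_mono K h m) x) = 0 := by
  cases m with
  | zero => simp [omegaNullHomotopic, hL]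
  | succ m =>
    have hb : OmegaBoundary K H m (Submodule.inclusion (Omega_mono K h (m + 1)) x) =
      Submodule.inclusion (Omega_mono K h m) (OmegaBoundary K G m x) := rfl
    simp [omegaNullHomotopic, hL, hb]

/-- If `L` vanishes on `Ω_*(G)` and `1 - ∂L - L∂` takes values in `Ω_*(G)`, then this map is a
deformation retraction of `Ω_*(H)` onto `Ω_*(G)`. -/
theorem exists_deformation_retraction (h : G ≤ H)
    (L : ∀ m, Omega K H m →ₗ[K] Omega K H (m + 1))
    (hL : ∀ m x, L m (Submodule.inclusion (Omega_mono K h m) x) = 0)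
    (hr : ∀ m x, ((x - omegaNullHomotopic K H L m x : Omega K H m) : Regular K V m) ∈
      Omega K G m) :
    ∃ P : pathComplex K H ⟶ pathComplex K G,
      pathInclusion K h ≫ P = 𝟙 (pathComplex K G) ∧
        Nonempty (Homotopy (P ≫ pathInclusion K h) (𝟙 (pathComplex K H))) := by
  let hom : ∀ i j, (ComplexShape.down ℕ).Rel j i → ((pathComplex K H).X i ⟶ (pathComplex K H).X j) :=
    fun i _ hij => hij ▸ ModuleCat.ofHom (L i)
  let N := Homotopy.nullHomotopicMap' hom
  have hd (m : ℕ) : (pathComplex K H).d (m + 1) m = ModuleCat.ofHom (OmegaBoundary K H m) := by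
    simp only [pathComplex, ChainComplex.of_d]
  have hN (m : ℕ) : N.f m = ModuleCat.ofHom (omegaNullHomotopic K H L m) := by
    cases m with
    | zero =>
      rw [Homotopy.nullHomotopicMap'_f_of_not_rel_left (k₁ := 1) rfl (by simp), hd]
      rfl
    | succ m =>
      rw [Homotopy.nullHomotopicMap'_f (k₂ := m + 2) (k₀ := m) rfl rfl, hd, hd]
      exact add_comm _ _
  let P (m : ℕ) : (pathComplex K H).X m ⟶ (pathComplex K G).X m :=
    ModuleCat.ofHom (LinearMap.codRestrict (Omega K G m)
      ((Omega K H m).subtype ∘ₗ (LinearMap.id - omegaNullHomotopic K H L m)) (hr m))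
  have hP (m : ℕ) : P m ≫ (pathInclusion K h).f m = (𝟙 (pathComplex K H) - N).f m := by
    rw [HomologicalComplex.sub_f_apply, hN]
    rfl
  have hmono (m : ℕ) : Mono ((pathInclusion K h).f m) :=
    (ModuleCat.mono_iff_injective _).2 (Submodule.inclusion_injective (Omega_mono K h m))
  -- The inclusion is mono in each degree, so `P` inherits compatibility with `∂` from `1 - N`.
  let Q : pathComplex K H ⟶ pathComplex K G := ChainComplex.ofHom P fun m => by
    rw [← cancel_mono ((pathInclusion K h).f m), Category.assoc, Category.assoc, hP,
      ← (pathInclusion K h).comm, ← Category.assoc, hP, HomologicalComplex.Hom.comm]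
  have hQ : Q ≫ pathInclusion K h = 𝟙 (pathComplex K H) - N := by
    ext1 m
    exact hP m
  refine ⟨Q, ?_, ⟨?_⟩⟩
  · ext1 m
    rw [← cancel_mono ((pathInclusion K h).f m), HomologicalComplex.comp_f, Category.assoc]
    change (pathInclusion K h).f m ≫ P m ≫ (pathInclusion K h).f m = _
    rw [hP, HomologicalComplex.sub_f_apply, hN]
    refine ModuleCat.hom_ext (LinearMap.ext fun x => ?_)
    change Submodule.inclusion (Omega_mono K h m) x -
      omegaNullHomotopic K H L m (Submodule.inclusion (Omega_mono K h m) x) =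
        Submodule.inclusion (Omega_mono K h m) x
    exact sub_eq_self.2 (omegaNullHomotopic_inclusion K h L hL m x)
  · rw [hQ]
    refine Homotopy.symm (Homotopy.equivSubZero.symm ?_)
    rw [sub_sub_cancel]
    exact Homotopy.nullHomotopy' hom

end Retract

/-! ### Correcting the homotopy operator to a strict retraction -/

section Main

variable (K : Type w) [Field K] {n : ℕ} {G H : Digraph (ZMod n)} {c d : ℕ}

theorem HasStepsUpTo.exists_deformation_retraction (hG : HasStepsUpTo G c)
    (hH : HasStepsUpTo H d) (h : G ≤ H) (hc : 1 ≤ c) (hcd : c ≤ d) (hn : 2 * d < n) :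
    ∃ P : pathComplex K H ⟶ pathComplex K G,
      pathInclusion K h ≫ P = 𝟙 (pathComplex K G) ∧
        Nonempty (Homotopy (P ≫ pathInclusion K h) (𝟙 (pathComplex K H))) := by
  let i (m : ℕ) := Submodule.inclusion (Omega_mono K h m)
  choose r hr using fun m => (i m).exists_leftInverse_of_injective
    (LinearMap.ker_eq_bot.2 (Submodule.inclusion_injective _))
  let D := omegaSubdivide K hH (hc.trans hcd) hn
  -- The formula for `D` does not depend on the digraph, so `D` restricts to `Ω_*(G)`.
  have hD (m : ℕ) (x : Omega K G m) :
      D m (i m x) = i (m + 1) (omegaSubdivide K hG hc (by omega) m x) := by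
    cases m <;> rfl
  have hri (m : ℕ) (x : Omega K G m) : r m (i m x) = x := LinearMap.congr_fun (hr m) x
  refine PathHomology.exists_deformation_retraction K h
    (fun m => i (m + 1) ∘ₗ r (m + 1) ∘ₗ D m - D m) (fun m x => ?_) (fun m x => ?_)
  · change i (m + 1) (r (m + 1) (D m (i m x))) - D m (i m x) = 0
    rw [hD, hri, sub_self]
  · cases m with
    | zero =>
      change _ ∈ allowed K G 0
      rw [allowed_zero]
      trivial
    | succ m =>
      -- This is `(1 + ∂D + D∂)x`: a sum of unit edges in degree `1`, and `0` above.
      have hmem : (x : Regular K (ZMod n) (m + 1)) + boundary K (ZMod n) (m + 1) (D (m + 1) x) +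
          D m (OmegaBoundary K H m x) ∈ Omega K G (m + 1) := by
        cases m with
        | zero =>
          rw [Omega_one]
          simpa [D, omegaSubdivide] using
            hG.boundary_subdivide_edge_add_mem K hc (by omega) x.2.1
        | succ m =>
          have := hH.boundary_subdivide_add_subdivide_boundary K hn x.2.1
          convert Submodule.zero_mem _
          exact (add_assoc _ _ _).trans (add_eq_zero_iff_eq_neg'.2 this)
      have hb := boundary_mem_Omega K G (m + 1) _ (r (m + 2) (D (m + 1) x)).2
      have hc := (r (m + 1) (D m (OmegaBoundary K H m x))).2
      convert Submodule.sub_mem _ (Submodule.sub_mem _ hmem hb) hc using 1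
      simp only [omegaNullHomotopic, OmegaBoundary, LinearMap.add_apply, LinearMap.comp_apply,
        LinearMap.sub_apply, map_sub, Submodule.coe_sub, Submodule.coe_add,
        LinearMap.coe_restrict_apply, i, Submodule.coe_inclusion]
      abel

end Main

end PathHomology

end

open PathHomology
theorem mainTheorem3 (K : Type*) [Field K] [CharZero K] (n d : ℕ) (hd : 2 < d) (hn : 2 * d < n) :
    ∃ P : pathComplex K (circulant n (stepsUpTo n d)) ⟶ pathComplex K (circulant n {1, 2}),
      pathInclusion K (circulant_mono (one_two_subset_stepsUpTo n hd)) ≫ P =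
          𝟙 (pathComplex K (circulant n {1, 2})) ∧
        Nonempty (Homotopy
          (P ≫ pathInclusion K (circulant_mono (one_two_subset_stepsUpTo n hd)))
          (𝟙 (pathComplex K (circulant n (stepsUpTo n d))))) := by
  have h12 : HasStepsUpTo (circulant n {1, 2}) 2 :=
    stepsUpTo_two n ▸ hasStepsUpTo_circulant (by omega)
  exact h12.exists_deformation_retraction K (hasStepsUpTo_circulant (by omega)) _ one_le_two
    hd.le hn
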